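/- Setting. Let $\mathcal G=(\mathcal V,\mathcal E)$ be an undirected graph on a finite set of users, let $\mathcal N_i$ denote the neighbourhood of $i$, with the convention $i\in\mathcal N_i$, and for each $i\in\mathcal V$ let $\mathcal A_i\subset\mathbb R^d$ be a finite set of contexts that spans $\mathbb R^d$. An arm is a pair $a=(i_a,u_a)$ with $u_a\in\mathcal A_{i_a}$; $\mathcal A$ is the set of arms. In every round $t=1,\dots,T$ a learning algorithm $\pi$ (which may be randomized and may depend on the horizon $T$) chooses, on the basis of the history of all earlier rounds, a context $U_i(t)\in\mathcal A_i$ for every node $i$, and then observes $y_{(i,j)}(t)=U_i(t)^{\top}\theta_j+\eta_{(i,j)}(t)$ for all $i\in\mathcal V$, $j\in\mathcal N_i$ (the case $j=i$ is the reward of $i$), where, given the history and the decisions of round $t$, the $\eta_{(i,j)}(t)$ are independent $\mathcal N(0,1)$ over all ordered pairs $(i,j)$ with $j\in\mathcal N_i$. For coefficients $\theta=(\theta_i)_{i\in\mathcal V}\in(\mathbb R^d)^{\mathcal V}$ put $\Delta_a=\max_{v\in\mathcal A_{i_a}}v^{\top}\theta_{i_a}-u_a^{\top}\theta_{i_a}$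 and let the regret be $R_\theta(T)=\mathbb E_\theta\sum_{t=1}^{T}\sum_{i\in\mathcal V}\Delta_{(i,U_i(t))}$. The algorithm is consistent if $R_\theta(T)=o(T^p)$ for every $p>0$ and every $\theta\in(\mathbb R^d)^{\mathcal V}$. Theorem. Let $\pi$ be a consistent learning algorithm and let $\theta^\star\in(\mathbb R^d)^{\mathcal V}$ be such that every node has exactly one optimal context. Let $\mathcal A^{(s)}=\{a\in\mathcal A:\Delta_a>0\}$ be the set of suboptimal arms, with gaps computed under $\theta^\star$, and let $$\bar G_i(T)=\mathbb E_{\theta^\star}\sum_{t=1}^{T}\sum_{j\in\mathcal N_i}U_j(t)U_j(t)^{\top}.$$ Write $\|x\|_M^2=x^{\top}Mx$. Then for every $i\in\mathcal V$ the matrix $\bar G_i(T)$ is positive definite for all sufficiently large $T$, and $$\limsup_{T\to\infty}\ \log(T)\,\|u_a\|^2_{\bar G_{i_a}(T)^{-1}}\le\frac{\Delta_a^2}{2}\qquad\text{for all }a\in\mathcal A^{(s)}.$$ Moreover, $$\limsup_{T\to\infty}\frac{R_{\theta^\star}(T)}{\log T}\ \ge\ c(\theta^\star,\mathcal G,\mathcal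 A),$$ where $c(\theta^\star,\mathcal G,\mathcal A)$ is the infimum of $\sum_{a\in\mathcal A^{(s)}}\alpha(a)\Delta_a$ over all $\alpha\in[0,\infty)^{\mathcal A}$ such that, for all $a\in\mathcal A^{(s)}$, the matrix $H_{i_a}(\alpha)$ is invertible and $\|u_a\|^2_{H_{i_a}(\alpha)^{-1}}\le\Delta_a^2/2$, with $H_i(\alpha)=\sum_{j\in\mathcal N_i}\sum_{a:\,i_a=j}\alpha(a)\,u_au_a^{\top}$. -/

import Mathlib

open MeasureTheory ProbabilityTheory Filter
open scoped Topology ENNReal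

namespace GraphBandit

noncomputable section

/-- `j` is in the neighbourhood `N_i` of `i`; every node is a neighbour of itself. -/
def Nbr {V : Type*} (G : SimpleGraph V) (i j : V) : Prop := i = j ∨ G.Adj i j

open Classical in
/-- The neighbourhood `N_i`, which contains `i`. -/
def nbhd {V : Type*} [Fintype V] (G : SimpleGraph V) (i : V) : Finset V :=
  Finset.univ.filter (fun j => Nbr G i j)

/-- Ordered pairs `(i, j)` such that recommending to `i` reveals an observation of user `j`.
The pair `(i, i)` carries the reward of `i`. -/
abbrev Link {V : Type*} (G : SimpleGraph V) : Type _ := {p : V × V // Nbr G p.1 p.2}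

instance {V : Type*} [Fintype V] (G : SimpleGraph V) : Fintype (Link G) :=
  Fintype.ofFinite _

/-- A joint decision in one round: one available context vector for each node. -/
abbrev Action {V : Type*} {d : ℕ} (A : V → Finset (Fin d → ℝ)) : Type _ := (i : V) → A i

/-- What is recorded in one round: the joint decision and all (side-)observations. -/
abbrev Outcome {V : Type*} {d : ℕ} (G : SimpleGraph V) (A : V → Finset (Fin d → ℝ)) : Type _ :=
  Action A × (Link G → ℝ)

/-- The history of the first `t` rounds. -/
abbrev Hist {V : Type*} {d : ℕ} (G : SimpleGraph V) (A : V → Finset (Fin d → ℝ)) (t : ℕ) :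
    Type _ :=
  Fin t → Outcome G A

/-- An arm `a = (i_a, u_a)`: a node together with one of its available contexts. -/
abbrev Arm {V : Type*} {d : ℕ} (A : V → Finset (Fin d → ℝ)) : Type _ := (i : V) × A i

/-- A (possibly randomized, possibly horizon-dependent) learning algorithm.  For the horizon `T`,
`act T t` gives the conditional law of the joint decision of the next round, given the history of
the `t` rounds played so far. A deterministic rule is the case of a deterministic kernel. -/
structure LearningAlgorithm {V : Type*} {d : ℕ} (G : SimpleGraph V)
    (A : V → Finset (Fin d → ℝ)) where
  act : (T t : ℕ) → Kernel (Hist G A t) (Action A)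
  markov : ∀ T t, IsMarkovKernel (act T t)

section Model

variable {V : Type*} [Fintype V] {d : ℕ} {G : SimpleGraph V} {A : V → Finset (Fin d → ℝ)}

/-- Given the joint decision `U`, the observations are independent, and the one on the link
`(i, j)` is normal with mean `U_i ⬝ θ_j` and variance `1`. -/
def obsKernel (G : SimpleGraph V) (A : V → Finset (Fin d → ℝ)) (θ : V → Fin d → ℝ) :
    Kernel (Action A) (Link G → ℝ) :=
  Kernel.ofFunOfCountable fun U =>
    Measure.pi fun p : Link G => gaussianReal ((U p.1.1 : Fin d → ℝ) ⬝ᵥ θ p.1.2) 1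

/-- The law of the history of the first `t` rounds when the algorithm, run with horizon `T`,
interacts with the instance with coefficients `θ`. -/
def law (π : LearningAlgorithm G A) (θ : V → Fin d → ℝ) (T : ℕ) : (t : ℕ) → Measure (Hist G A t)
  | 0 => Measure.dirac Fin.elim0
  | t + 1 =>
      ((law π θ T t) ⊗ₘ (π.act T t ⊗ₖ Kernel.prodMkLeft (Hist G A t) (obsKernel G A θ))).map
        (fun p => (Fin.snoc p.1 p.2 : Hist G A (t + 1)))

/-- The gap `Δ_a` of an arm: the best mean reward at its node minus its own mean reward. -/
def gap (θ : V → Fin d → ℝ) (a : Arm A) : ℝ :=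
  (⨆ v : A a.1, (v : Fin d → ℝ) ⬝ᵥ θ a.1) - (a.2 : Fin d → ℝ) ⬝ᵥ θ a.1

/-- The suboptimal arms. -/
def subopt (A : V → Finset (Fin d → ℝ)) (θ : V → Fin d → ℝ) : Set (Arm A) := {a | 0 < gap θ a}

/-- The regret `R(T)` over `T` rounds. -/
def regret (π : LearningAlgorithm G A) (θ : V → Fin d → ℝ) (T : ℕ) : ℝ :=
  ∫ h : Hist G A T, ∑ s : Fin T, ∑ i : V, gap θ (⟨i, (h s).1 i⟩ : Arm A) ∂(law π θ T T)

/-- Consistency: the regret is `o(T ^ p)` for all `p > 0` and all coefficients. -/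
def Consistent (π : LearningAlgorithm G A) : Prop :=
  ∀ θ : V → Fin d → ℝ, ∀ p : ℝ, 0 < p →
    (fun T : ℕ => regret π θ T) =o[atTop] (fun T : ℕ => (T : ℝ) ^ p)

/-- The Gram matrix `G_i` of a history: the sum of `U_j(s) U_j(s)ᵀ` over all rounds `s` and all
neighbours `j` of `i`. -/
def gram {t : ℕ} (h : Hist G A t) (i : V) : Matrix (Fin d) (Fin d) ℝ :=
  ∑ s : Fin t, ∑ j ∈ nbhd G i, Matrix.vecMulVec ((h s).1 j : Fin d → ℝ) ((h s).1 j : Fin d → ℝ)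

/-- The expected Gram matrix `Ḡ_i(T)` (entrywise expectation). -/
def expGram (π : LearningAlgorithm G A) (θ : V → Fin d → ℝ) (T : ℕ) (i : V) :
    Matrix (Fin d) (Fin d) ℝ :=
  Matrix.of fun k l => ∫ h : Hist G A T, gram h i k l ∂(law π θ T T)

/-- The weighted square norm `‖x‖²_M = xᵀ M x`. -/
def wnormSq (M : Matrix (Fin d) (Fin d) ℝ) (x : Fin d → ℝ) : ℝ := x ⬝ᵥ M.mulVec x

/-- `H_i(α)`: the sum of `α(a) u_a u_aᵀ` over all arms `a` at neighbours of `i`. -/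
def designMatrix (G : SimpleGraph V) (α : Arm A → ℝ) (i : V) : Matrix (Fin d) (Fin d) ℝ :=
  ∑ j ∈ nbhd G i, ∑ u : A j, α ⟨j, u⟩ • Matrix.vecMulVec (u : Fin d → ℝ) (u : Fin d → ℝ)

/-- The feasible set of the optimization problem. -/
def feasible (G : SimpleGraph V) (A : V → Finset (Fin d → ℝ)) (θ : V → Fin d → ℝ) :
    Set (Arm A → ℝ) :=
  {α | (∀ a, 0 ≤ α a) ∧ ∀ a ∈ subopt A θ, (designMatrix G α a.1).PosDef ∧
    wnormSq (designMatrix G α a.1)⁻¹ (a.2 : Fin d → ℝ) ≤ gap θ a ^ 2 / 2}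

open Classical in
/-- The objective of the optimization problem: the sum of `α(a) Δ_a` over suboptimal arms. -/
def cost (θ : V → Fin d → ℝ) (α : Arm A → ℝ) : ℝ :=
  ∑ a ∈ Finset.univ.filter (fun a => a ∈ subopt A θ), α a * gap θ a

/-- The optimal value `c(θ, G, A)`: the infimum of the objective over the feasible set. -/
def optValue (G : SimpleGraph V) (A : V → Finset (Fin d → ℝ)) (θ : V → Fin d → ℝ) : EReal :=
  ⨅ α ∈ feasible G A θ, ((cost θ α : ℝ) : EReal)

end Model

end

end GraphBandit

/-! A consistent algorithm must tell the given instance from every instance in which only `θ i`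
moves, to `θ i + δ`, and some context overtakes the optimal one of node `i`. The formerly optimal
context is avoided in only `o(T^p)` rounds before the change and played in only `o(T^p)` rounds
after it. The decision kernels cancel in the likelihood ratio, and only observations of user `i`
change, so the divergence between the two laws is half the form of `expGram` at `δ`. Testing with
the fraction of rounds in which the context is played (`exp_neg_info_le`) shows that, for each fixed
such `δ` and each `c < 2`, this form is eventually at least `c * log T`.

The norm of a nonzero `u` in the inverse matrix is the reciprocal of the minimum of the form on the
hyperplane `u ⬝ᵥ δ = 1`, so the bound is needed uniformly there. Compactness supplies this in
`eventually_le_qform`: violating vectors are rescaled and pass to a limit along an ultrafilter. The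
optimal arm has weight of order `T / log T`, which tends to infinity, so the limit is orthogonal to
the optimal context. Stretching the limit direction just enough to let `u` overtake contradicts the
bound for a fixed `δ`. Positive definiteness comes from the same mechanism.

For the regret, the expected pulls divided by `log T` and enlarged by any factor `c > 1` are
eventually feasible, at cost `c * regret / log T`. -/

namespace GraphBandit

/-! ### Gaussian densities and their products. -/

section Gaussian

/-- On a finite product, the product of measures with integrable densities has the product
density. -/
theorem pi_withDensity_ofReal {ι : Type*} [Fintype ι] {X : ι → Type*}
    [∀ i, MeasurableSpace (X i)] (μ : ∀ i, Measure (X i)) [∀ i, SigmaFinite (μ i)]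
    (f : ∀ i, X i → ℝ) (hf : ∀ i, Integrable (f i) (μ i)) (h0 : ∀ i x, 0 ≤ f i x) :
    Measure.pi (fun i => (μ i).withDensity fun x => ENNReal.ofReal (f i x)) =
      (Measure.pi μ).withDensity fun x => ENNReal.ofReal (∏ i, f i (x i)) := by
  have (i : ι) : IsFiniteMeasure ((μ i).withDensity fun x => ENNReal.ofReal (f i x)) :=
    isFiniteMeasure_withDensity_ofReal (hf i).2
  refine Measure.pi_eq fun s hs => ?_
  rw [withDensity_apply _ (MeasurableSet.univ_pi hs), Measure.restrict_pi_pi,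
    ← ofReal_integral_eq_lintegral_ofReal
      (Integrable.fintype_prod_dep fun i => (hf i).restrict)
      (ae_of_all _ fun x => Finset.prod_nonneg fun i _ => h0 i _),
    integral_fintype_prod_eq_prod,
    ENNReal.ofReal_prod_of_nonneg fun i _ => integral_nonneg fun x => h0 i x]
  refine Finset.prod_congr rfl fun i _ => ?_
  rw [withDensity_apply _ (hs i), ofReal_integral_eq_lintegral_ofReal (hf i).restrict
    (ae_of_all _ fun x => h0 i x)]

/-- The density of a unit-variance Gaussian with respect to another one. -/
theorem gaussianReal_eq_withDensity (m m' : ℝ) :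
    gaussianReal m' 1 = (gaussianReal m 1).withDensity fun x =>
      ENNReal.ofReal (Real.exp ((x - m) * (m' - m) - (m' - m) ^ 2 / 2)) := by
  rw [gaussianReal_of_var_ne_zero _ one_ne_zero, gaussianReal_of_var_ne_zero _ one_ne_zero,
    ← withDensity_mul _ (measurable_gaussianPDF _ _) (by fun_prop)]
  congr 1
  ext x
  simp only [Pi.mul_apply, gaussianPDF]
  rw [← ENNReal.ofReal_mul (gaussianPDFReal_nonneg _ _ _), gaussianPDFReal, gaussianPDFReal,
    mul_assoc, mul_assoc, ← Real.exp_add]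
  congr 3
  simp only [NNReal.coe_one]
  ring

/-- The function is a density of one probability measure with respect to another, so its integral is
read off from the total mass. -/
theorem integrable_exp_gaussianReal (m m' : ℝ) :
    Integrable (fun x => Real.exp ((x - m) * (m' - m) - (m' - m) ^ 2 / 2)) (gaussianReal m 1) := by
  refine ⟨by fun_prop, ?_⟩
  rw [hasFiniteIntegral_iff_ofReal (ae_of_all _ fun x => (Real.exp_pos _).le)]
  have h : ∫⁻ x, 1 ∂(gaussianReal m' 1) < ∞ := by simp
  rw [gaussianReal_eq_withDensity m m', lintegral_withDensity_eq_lintegral_mul _ (by fun_prop)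
    (by fun_prop)] at h
  simpa using h

theorem integrable_sub_mean_gaussianReal (m : ℝ) :
    Integrable (fun x => x - m) (gaussianReal m 1) :=
  ((memLp_id_gaussianReal 1).integrable le_rfl).sub (integrable_const _)

theorem integral_sub_mean_gaussianReal (m : ℝ) : ∫ x, (x - m) ∂(gaussianReal m 1) = 0 := by
  have h := integral_sub ((memLp_id_gaussianReal (μ := m) (v := 1) 1).integrable le_rfl)
    (integrable_const m)
  simpa using h

end Gaussian

/-! ### Likelihood ratios of histories and the change of measure. -/

section Model

variable {V : Type*} [Fintype V] {d : ℕ} {G : SimpleGraph V} {A : V → Finset (Fin d → ℝ)}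

/-- The expected observation on a link. -/
noncomputable def linkMean (θ : V → Fin d → ℝ) (U : Action A) (p : Link G) : ℝ :=
  (U p.1.1 : Fin d → ℝ) ⬝ᵥ θ p.1.2

/-- The noise part of the log-likelihood ratio of the observations of one round. -/
noncomputable def roundNoise (θ θ' : V → Fin d → ℝ) (o : Outcome G A) : ℝ :=
  ∑ p : Link G, (o.2 p - linkMean θ o.1 p) * (linkMean θ' o.1 p - linkMean θ o.1 p)

/-- Twice the Kullback–Leibler divergence of the observations of one round, given the decision. -/
noncomputable def roundInfo (G : SimpleGraph V) (θ θ' : V → Fin d → ℝ) (U : Action A) : ℝ :=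
  ∑ p : Link G, (linkMean θ' U p - linkMean θ U p) ^ 2

/-- The log-likelihood ratio of the observations of one round. -/
noncomputable def roundLLR (θ θ' : V → Fin d → ℝ) (o : Outcome G A) : ℝ :=
  roundNoise θ θ' o - roundInfo G θ θ' o.1 / 2

/-- The log-likelihood ratio of a history. -/
noncomputable def llr (θ θ' : V → Fin d → ℝ) {t : ℕ} (h : Hist G A t) : ℝ :=
  ∑ s, roundLLR θ θ' (h s)

/-- The noise part of the log-likelihood ratio of a history. -/
noncomputable def noise (θ θ' : V → Fin d → ℝ) {t : ℕ} (h : Hist G A t) : ℝ :=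
  ∑ s, roundNoise θ θ' (h s)

theorem measurable_linkMean (θ : V → Fin d → ℝ) (p : Link G) :
    Measurable (fun U : Action A => linkMean θ U p) := by
  exact measurable_of_countable _

@[fun_prop]
theorem measurable_roundNoise (θ θ' : V → Fin d → ℝ) :
    Measurable (roundNoise θ θ' : Outcome G A → ℝ) := by
  have h := fun p : Link G => (measurable_linkMean (A := A) θ p).comp
    (measurable_fst : Measurable (Prod.fst : Outcome G A → _))
  have h' := fun p : Link G => (measurable_linkMean (A := A) θ' p).comp
    (measurable_fst : Measurable (Prod.fst : Outcome G A → _))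
  exact Finset.measurable_sum _ fun p _ =>
    (((measurable_pi_apply p).comp measurable_snd).sub (h p)).mul ((h' p).sub (h p))

@[fun_prop]
theorem measurable_roundLLR (θ θ' : V → Fin d → ℝ) :
    Measurable (roundLLR θ θ' : Outcome G A → ℝ) := by
  have h : Measurable (roundInfo G θ θ' : Action A → ℝ) := measurable_of_countable _
  exact (measurable_roundNoise θ θ').sub ((h.comp measurable_fst).div_const 2)

@[fun_prop]
theorem measurable_llr (θ θ' : V → Fin d → ℝ) (t : ℕ) :
    Measurable (llr θ θ' : Hist G A t → ℝ) :=
  Finset.measurable_sum _ fun s _ => (measurable_roundLLR θ θ').comp (measurable_pi_apply s)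

@[fun_prop]
theorem measurable_noise (θ θ' : V → Fin d → ℝ) (t : ℕ) :
    Measurable (noise θ θ' : Hist G A t → ℝ) :=
  Finset.measurable_sum _ fun s _ => (measurable_roundNoise θ θ').comp (measurable_pi_apply s)

instance (θ : V → Fin d → ℝ) : IsMarkovKernel (obsKernel G A θ) :=
  ⟨fun U => by
    change IsProbabilityMeasure (Measure.pi fun p : Link G =>
      gaussianReal ((U p.1.1 : Fin d → ℝ) ⬝ᵥ θ p.1.2) 1)
    infer_instance⟩

instance (π : LearningAlgorithm G A) (T t : ℕ) : IsMarkovKernel (π.act T t) := π.markov T t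

theorem obsKernel_apply (θ : V → Fin d → ℝ) (U : Action A) :
    obsKernel G A θ U = Measure.pi fun p : Link G => gaussianReal (linkMean θ U p) 1 := rfl

theorem obsKernel_eq_withDensity (θ θ' : V → Fin d → ℝ) (U : Action A) :
    obsKernel G A θ' U = (obsKernel G A θ U).withDensity fun y =>
      ENNReal.ofReal (Real.exp (roundLLR θ θ' (U, y))) := by
  rw [obsKernel_apply, obsKernel_apply]
  simp_rw [fun p : Link G => gaussianReal_eq_withDensity (linkMean θ U p) (linkMean θ' U p)]
  rw [pi_withDensity_ofReal _ _ (fun p => integrable_exp_gaussianReal _ _)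
    fun p x => (Real.exp_pos _).le]
  congr 1
  ext y
  rw [← Real.exp_sum, roundLLR, roundNoise, roundInfo, Finset.sum_div, Finset.sum_sub_distrib]

theorem integrable_noise_term (θ : V → Fin d → ℝ) (U : Action A) (p : Link G) :
    Integrable (fun y => y p - linkMean θ U p) (obsKernel G A θ U) := by
  rw [obsKernel_apply]
  exact integrable_comp_eval (μ := fun p : Link G => gaussianReal (linkMean θ U p) 1)
    (integrable_sub_mean_gaussianReal (linkMean θ U p))

theorem integrable_roundNoise (θ θ' : V → Fin d → ℝ) (U : Action A) :
    Integrable (fun y => roundNoise θ θ' (U, y)) (obsKernel G A θ U) :=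
  integrable_finsetSum _ fun p _ => (integrable_noise_term θ U p).mul_const
    (linkMean θ' U p - linkMean θ U p)

theorem integral_roundNoise (θ θ' : V → Fin d → ℝ) (U : Action A) :
    ∫ y, roundNoise θ θ' (U, y) ∂(obsKernel G A θ U) = 0 := by
  simp only [roundNoise]
  rw [integral_finsetSum _ fun p _ => (integrable_noise_term θ U p).mul_const _]
  refine Finset.sum_eq_zero fun p _ => ?_
  have h := integral_comp_eval (μ := fun p : Link G => gaussianReal (linkMean θ U p) 1) (i := p)
    (integrable_sub_mean_gaussianReal (linkMean θ U p)).1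
  rw [integral_mul_const, obsKernel_apply, h, integral_sub_mean_gaussianReal, zero_mul]

omit [Fintype V] in
@[fun_prop]
theorem measurable_snoc (t : ℕ) :
    Measurable (fun p : Hist G A t × Outcome G A => (Fin.snoc p.1 p.2 : Hist G A (t + 1))) := by
  refine measurable_pi_lambda _ fun s => ?_
  refine Fin.lastCases ?_ (fun s => ?_) s
  · simpa using measurable_snd
  · simp only [Fin.snoc_castSucc]
    exact (measurable_pi_apply s).comp measurable_fst

instance isProbabilityMeasure_law (π : LearningAlgorithm G A) (θ : V → Fin d → ℝ) (T t : ℕ) :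
    IsProbabilityMeasure (law π θ T t) := by
  induction t with
  | zero => rw [law]; infer_instance
  | succ t ih => rw [law]; exact Measure.isProbabilityMeasure_map (by fun_prop)

theorem lintegral_law_succ (π : LearningAlgorithm G A) (θ : V → Fin d → ℝ) (T t : ℕ)
    {g : Hist G A (t + 1) → ℝ≥0∞} (hg : Measurable g) :
    ∫⁻ h, g h ∂(law π θ T (t + 1)) = ∫⁻ h, ∫⁻ U, ∫⁻ y, g (Fin.snoc h ((U, y) : Outcome G A))
      ∂(obsKernel G A θ U) ∂(π.act T t h) ∂(law π θ T t) := by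
  rw [law, lintegral_map hg (by fun_prop), Measure.lintegral_compProd (by fun_prop)]
  refine lintegral_congr fun h => ?_
  rw [Kernel.lintegral_compProd _ _ _ (by fun_prop)]
  rfl

theorem integral_law_succ (π : LearningAlgorithm G A) (θ : V → Fin d → ℝ) (T t : ℕ)
    {g : Hist G A (t + 1) → ℝ} (hg : Integrable g (law π θ T (t + 1))) :
    ∫ h, g h ∂(law π θ T (t + 1)) = ∫ h, ∫ U, ∫ y, g (Fin.snoc h ((U, y) : Outcome G A))
      ∂(obsKernel G A θ U) ∂(π.act T t h) ∂(law π θ T t) := by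
  rw [law] at hg ⊢
  have hs : AEMeasurable (fun p : Hist G A t × Outcome G A =>
      (Fin.snoc p.1 p.2 : Hist G A (t + 1))) (law π θ T t ⊗ₘ
        (π.act T t ⊗ₖ Kernel.prodMkLeft (Hist G A t) (obsKernel G A θ))) :=
    (measurable_snoc t).aemeasurable
  have hi := (integrable_map_measure hg.1 hs).1 hg
  rw [integral_map hs hg.1]
  refine (Measure.integral_compProd hi).trans ?_
  refine integral_congr_ae ?_
  filter_upwards [((Measure.integrable_compProd_iff hi.1).1 hi).1] with h hh
  rw [integral_compProd hh]
  rfl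

theorem llr_snoc (θ θ' : V → Fin d → ℝ) {t : ℕ} (h : Hist G A t) (o : Outcome G A) :
    llr θ θ' (Fin.snoc h o : Hist G A (t + 1)) = llr θ θ' h + roundLLR θ θ' o := by
  simp [llr, Fin.sum_univ_castSucc]

theorem noise_snoc (θ θ' : V → Fin d → ℝ) {t : ℕ} (h : Hist G A t) (o : Outcome G A) :
    noise θ θ' (Fin.snoc h o : Hist G A (t + 1)) = noise θ θ' h + roundNoise θ θ' o := by
  simp [noise, Fin.sum_univ_castSucc]

/-- Induction on the rounds: the decision kernel is the same under both parameters, so each round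
contributes only the density of its observations. -/
theorem lintegral_law_change (π : LearningAlgorithm G A) (θ θ' : V → Fin d → ℝ) (T t : ℕ)
    {g : Hist G A t → ℝ≥0∞} (hg : Measurable g) :
    ∫⁻ h, g h ∂(law π θ' T t) =
      ∫⁻ h, g h * ENNReal.ofReal (Real.exp (llr θ θ' h)) ∂(law π θ T t) := by
  induction t with
  | zero => simp [law, llr]
  | succ t ih =>
    rw [lintegral_law_succ _ _ _ _ hg, lintegral_law_succ _ _ _ _ (by fun_prop), ih]
    · refine lintegral_congr fun h => ?_
      rw [← lintegral_mul_const' _ _ ENNReal.ofReal_ne_top]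
      refine lintegral_congr fun U => ?_
      rw [← lintegral_mul_const' _ _ ENNReal.ofReal_ne_top, obsKernel_eq_withDensity θ θ',
        lintegral_withDensity_eq_lintegral_mul _ (by fun_prop) (by fun_prop)]
      refine lintegral_congr fun y => ?_
      rw [llr_snoc, Real.exp_add, ENNReal.ofReal_mul (Real.exp_pos _).le]
      simp only [Pi.mul_apply]
      ring
    · have h1 : Measurable fun p : Hist G A t × Outcome G A =>
          g (Fin.snoc p.1 p.2 : Hist G A (t + 1)) := by fun_prop
      have h2 := Measurable.lintegral_kernel_prod_right'
        (κ := π.act T t ⊗ₖ Kernel.prodMkLeft (Hist G A t) (obsKernel G A θ')) h1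
      convert h2 using 2 with h
      rw [Kernel.lintegral_compProd _ _ _ (by fun_prop)]
      rfl

/-- The sum of `roundInfo` over the rounds of a history. -/
noncomputable def info (θ θ' : V → Fin d → ℝ) {t : ℕ} (h : Hist G A t) : ℝ :=
  ∑ s, roundInfo G θ θ' (h s).1

theorem measurable_comp_decision {E : Type*} [MeasurableSpace E] {t : ℕ} (f : Action A → E)
    (s : Fin t) : Measurable (fun h : Hist G A t => f (h s).1) :=
  (measurable_of_countable f).comp (measurable_fst.comp (measurable_pi_apply s))

theorem integrable_comp_decision (π : LearningAlgorithm G A) (θ : V → Fin d → ℝ) (T t : ℕ)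
    (f : Action A → ℝ) (s : Fin t) : Integrable (fun h => f (h s).1) (law π θ T t) := by
  obtain ⟨C, hC⟩ := (Set.finite_range fun U => ‖f U‖).bddAbove
  exact .of_bound (measurable_comp_decision f s).aestronglyMeasurable C
    (ae_of_all _ fun h => hC ⟨_, rfl⟩)

theorem integrable_info (π : LearningAlgorithm G A) (θ θ₁ θ₂ : V → Fin d → ℝ) (T t : ℕ) :
    Integrable (fun h => info θ₁ θ₂ h) (law π θ T t) :=
  integrable_finsetSum _ fun s _ => integrable_comp_decision π θ T t _ s

theorem llr_eq (θ θ' : V → Fin d → ℝ) {t : ℕ} (h : Hist G A t) :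
    llr θ θ' h = noise θ θ' h - info θ θ' h / 2 := by
  simp only [llr, noise, info, roundLLR, Finset.sum_sub_distrib, Finset.sum_div]

theorem integrable_exp_llr (π : LearningAlgorithm G A) (θ θ' : V → Fin d → ℝ) (T t : ℕ) :
    Integrable (fun h => Real.exp (llr θ θ' h)) (law π θ T t) := by
  refine ⟨by fun_prop, ?_⟩
  rw [hasFiniteIntegral_iff_ofReal (ae_of_all _ fun x => (Real.exp_pos _).le)]
  have h := lintegral_law_change π θ θ' T t (measurable_const (a := 1))
  simp only [one_mul, lintegral_const, measure_univ] at h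
  rw [← h]
  exact ENNReal.one_lt_top

theorem integral_exp_llr (π : LearningAlgorithm G A) (θ θ' : V → Fin d → ℝ) (T t : ℕ) :
    ∫ h, Real.exp (llr θ θ' h) ∂(law π θ T t) = 1 := by
  have h := lintegral_law_change π θ θ' T t (measurable_const (a := 1))
  simp only [one_mul, lintegral_const, measure_univ] at h
  rw [integral_eq_lintegral_of_nonneg_ae (ae_of_all _ fun x => (Real.exp_pos _).le) (by fun_prop),
    ← h]
  simp

theorem integral_law_change (π : LearningAlgorithm G A) (θ θ' : V → Fin d → ℝ) (T t : ℕ)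
    {g : Hist G A t → ℝ} (hg : Measurable g) (h0 : ∀ h, 0 ≤ g h) :
    ∫ h, g h ∂(law π θ' T t) = ∫ h, g h * Real.exp (llr θ θ' h) ∂(law π θ T t) := by
  rw [integral_eq_lintegral_of_nonneg_ae (ae_of_all _ h0) (by fun_prop),
    integral_eq_lintegral_of_nonneg_ae
      (ae_of_all _ fun x => mul_nonneg (h0 x) (Real.exp_pos _).le) (by fun_prop),
    lintegral_law_change π θ θ' T t (by fun_prop)]
  simp_rw [ENNReal.ofReal_mul (h0 _)]

/-- The noise differs from `llr` by half of `info`, which is bounded because there are finitely many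
joint decisions. -/
theorem integrable_exp_noise (π : LearningAlgorithm G A) (θ θ' : V → Fin d → ℝ) (T t : ℕ) :
    Integrable (fun h => Real.exp (noise θ θ' h)) (law π θ T t) := by
  obtain ⟨C, hC⟩ := (Set.finite_range fun U => roundInfo G θ θ' (A := A) U).bddAbove
  refine ((integrable_exp_llr π θ θ' T t).mul_const (Real.exp (t * C / 2))).mono'
    (by fun_prop) (ae_of_all _ fun h => ?_)
  rw [Real.norm_of_nonneg (Real.exp_pos _).le, ← Real.exp_add, Real.exp_le_exp, llr_eq]
  have : info θ θ' h ≤ t * C := by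
    refine (Finset.sum_le_card_nsmul _ _ C fun s _ => hC ⟨_, rfl⟩).trans_eq ?_
    simp
  linarith

/-- The noise is linear in `θ' - θ`, and `θ + θ - θ'` is the reflection of `θ'` in `θ`. Exponential
integrability thus also holds for the negated noise, and `|x| ≤ exp x + exp (-x)` yields
integrability of the noise itself. -/
theorem noise_reflect (θ θ' : V → Fin d → ℝ) {t : ℕ} (h : Hist G A t) :
    noise θ (θ + θ - θ') h = -noise θ θ' h := by
  simp only [noise, roundNoise, linkMean, ← Finset.sum_neg_distrib]
  refine Finset.sum_congr rfl fun s _ => Finset.sum_congr rfl fun p _ => ?_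
  simp only [Pi.sub_apply, Pi.add_apply, dotProduct_sub, dotProduct_add]
  ring

theorem integrable_noise (π : LearningAlgorithm G A) (θ θ' : V → Fin d → ℝ) (T t : ℕ) :
    Integrable (fun h => noise θ θ' h) (law π θ T t) := by
  refine ((integrable_exp_noise π θ θ' T t).add
    (integrable_exp_noise π θ (θ + θ - θ') T t)).mono' (by fun_prop) (ae_of_all _ fun h => ?_)
  simp only [Pi.add_apply, noise_reflect, Real.norm_eq_abs]
  have h1 := Real.add_one_le_exp (noise θ θ' h)
  have h2 := Real.add_one_le_exp (-noise θ θ' h)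
  have h3 := Real.exp_pos (noise θ θ' h)
  have h4 := Real.exp_pos (-noise θ θ' h)
  exact abs_le.2 ⟨by linarith, by linarith⟩

/-- Every round adds a term of mean zero given the past and the decision. -/
theorem integral_noise (π : LearningAlgorithm G A) (θ θ' : V → Fin d → ℝ) (T t : ℕ) :
    ∫ h, noise θ θ' h ∂(law π θ T t) = 0 := by
  induction t with
  | zero => simp [noise]
  | succ t ih =>
    rw [integral_law_succ _ _ _ _ (integrable_noise π θ θ' T _), ← ih]
    refine integral_congr_ae (ae_of_all _ fun h => ?_)
    simp only [noise_snoc]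
    have hy (U : Action A) : ∫ y, (noise θ θ' h + roundNoise θ θ' (U, y)) ∂(obsKernel G A θ U) =
        noise θ θ' h := by
      rw [integral_add (integrable_const _) (integrable_roundNoise θ θ' U), integral_roundNoise]
      simp
    simp_rw [hy]
    simp

/-- A Bretagnolle–Huber type inequality: no test separates the histories under two parameters
better than their Kullback–Leibler divergence permits. -/
theorem exp_neg_info_le (π : LearningAlgorithm G A) (θ θ' : V → Fin d → ℝ) (T t : ℕ)
    {f : Hist G A t → ℝ} (hf : Measurable f) (h0 : ∀ h, 0 ≤ f h) (h1 : ∀ h, f h ≤ 1) :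
    Real.exp (-1 - (∫ h, info θ θ' h ∂(law π θ T t)) / 2) ≤
      (∫ h, (1 - f h) ∂(law π θ T t)) + ∫ h, f h ∂(law π θ' T t) := by
  set K := (∫ h, info θ θ' h ∂(law π θ T t)) / 2 with hK
  have hL : Integrable (fun h => llr θ θ' h) (law π θ T t) := by
    simp_rw [llr_eq]
    exact (integrable_noise ..).sub ((integrable_info ..).div_const _)
  have hEL : ∫ h, llr θ θ' h ∂(law π θ T t) = -K := by
    simp_rw [llr_eq]
    rw [integral_sub (integrable_noise ..) ((integrable_info ..).div_const _), integral_noise,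
      integral_div]
    simp [hK]
  have hfi : Integrable f (law π θ T t) :=
    .of_bound hf.aestronglyMeasurable 1 (ae_of_all _ fun h => by
      rw [Real.norm_of_nonneg (h0 h)]; exact h1 h)
  have hfe : Integrable (fun h => f h * Real.exp (llr θ θ' h)) (law π θ T t) :=
    (integrable_exp_llr π θ θ' T t).mono' (by fun_prop) (ae_of_all _ fun h => by
      rw [Real.norm_of_nonneg (mul_nonneg (h0 h) (Real.exp_pos _).le)]
      exact mul_le_of_le_one_left (Real.exp_pos _).le (h1 h))
  -- With `x` the log-likelihood ratio, the right side is at least `exp (min 0 x)`, and `min 0 x ≥ x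
  -- - exp x`. The left side is the tangent of `exp` at `-1 - K`, evaluated at `x - exp x`. Since `x
  -- - exp x` has mean exactly `-K - 1`, integrating the tangent gives `exp (-1 - K)`, as in
  -- Jensen's inequality.
  have key : ∀ h : Hist G A t, Real.exp (-1 - K) * (1 + llr θ θ' h - Real.exp (llr θ θ' h) + 1 + K)
      ≤ (1 - f h) + f h * Real.exp (llr θ θ' h) := by
    intro h
    set x := llr θ θ' h
    have hmin : Real.exp (min 0 x) ≤ (1 - f h) + f h * Real.exp x := by
      rcases le_total 0 x with hx | hx
      · rw [min_eq_left hx, Real.exp_zero]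
        nlinarith [Real.one_le_exp hx, h0 h]
      · rw [min_eq_right hx]
        nlinarith [Real.exp_le_one_iff.2 hx, h1 h]
    refine le_trans ?_ hmin
    have h2 : x - Real.exp x ≤ min 0 x := by
      refine le_min ?_ ?_
      · linarith [Real.add_one_le_exp x]
      · linarith [Real.exp_pos x]
    have h3 := Real.add_one_le_exp (min 0 x - (-1 - K))
    calc _ ≤ Real.exp (-1 - K) * Real.exp (min 0 x - (-1 - K)) := by
          gcongr; linarith
      _ = _ := by rw [← Real.exp_add]; ring_nf
  have hfs : Integrable (fun h => 1 - f h) (law π θ T t) := (integrable_const _).sub hfi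
  rw [integral_law_change π θ θ' T t hf h0, ← integral_add hfs hfe]
  have h3 : Integrable (fun h => Real.exp (-1 - K) *
      (1 + llr θ θ' h - Real.exp (llr θ θ' h) + 1 + K)) (law π θ T t) :=
    (((((integrable_const _).add hL).sub (integrable_exp_llr ..)).add (integrable_const _)).add
      (integrable_const _)).const_mul _
  refine le_trans (le_of_eq ?_) (integral_mono h3 (hfs.add hfe) key)
  have h4 : ∀ h : Hist G A t, 1 + llr θ θ' h - Real.exp (llr θ θ' h) + 1 + K =
      (llr θ θ' h - Real.exp (llr θ θ' h)) + (2 + K) := fun h => by ring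
  simp_rw [h4]
  have h5 : Integrable (fun h => llr θ θ' h - Real.exp (llr θ θ' h)) (law π θ T t) :=
    hL.sub (integrable_exp_llr ..)
  rw [integral_const_mul, integral_add h5 (integrable_const _),
    integral_sub hL (integrable_exp_llr ..), hEL, integral_exp_llr]
  simp
  ring

end Model

/-! ### Expected pulls, regret, and the information bound for a fixed parameter change. -/

section Counts

variable {V : Type*} [Fintype V] {d : ℕ} {G : SimpleGraph V} {A : V → Finset (Fin d → ℝ)}

open Classical in
/-- The number of times an arm is played in a history. -/
noncomputable def count {t : ℕ} (h : Hist G A t) (a : Arm A) : ℝ :=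
  ∑ s : Fin t, if (h s).1 a.1 = a.2 then 1 else 0

/-- The expected number of times an arm is played. -/
noncomputable def pulls (π : LearningAlgorithm G A) (θ : V → Fin d → ℝ) (T : ℕ) (a : Arm A) : ℝ :=
  ∫ h : Hist G A T, count h a ∂(law π θ T T)

omit [Fintype V] in
theorem count_nonneg {t : ℕ} (h : Hist G A t) (a : Arm A) : 0 ≤ count h a :=
  Finset.sum_nonneg fun s _ => by positivity

omit [Fintype V] in
theorem count_le {t : ℕ} (h : Hist G A t) (a : Arm A) : count h a ≤ t := by
  refine (Finset.sum_le_card_nsmul _ _ 1 fun s _ => ?_).trans_eq (by simp)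
  split_ifs <;> norm_num

theorem measurable_count (t : ℕ) (a : Arm A) : Measurable fun h : Hist G A t => count h a := by
  classical
  refine Finset.measurable_sum _ fun s _ => ?_
  exact measurable_comp_decision (fun U : Action A => if U a.1 = a.2 then (1 : ℝ) else 0) s

theorem integrable_count (π : LearningAlgorithm G A) (θ : V → Fin d → ℝ) (T t : ℕ) (a : Arm A) :
    Integrable (fun h => count h a) (law π θ T t) :=
  .of_bound (measurable_count t a).aestronglyMeasurable t (ae_of_all _ fun h => by
    rw [Real.norm_of_nonneg (count_nonneg h a)]; exact count_le h a)

theorem pulls_nonneg (π : LearningAlgorithm G A) (θ : V → Fin d → ℝ) (T : ℕ) (a : Arm A) :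
    0 ≤ pulls π θ T a :=
  integral_nonneg fun h => count_nonneg h a

omit [Fintype V] in
theorem sum_decision_eq {t : ℕ} (h : Hist G A t) (i : V) (g : A i → ℝ) :
    ∑ s, g ((h s).1 i) = ∑ u, count h ⟨i, u⟩ * g u := by
  classical
  simp only [count, Finset.sum_mul]
  rw [Finset.sum_comm]
  refine Finset.sum_congr rfl fun s _ => ?_
  simp

theorem integral_sum_decision (π : LearningAlgorithm G A) (θ : V → Fin d → ℝ) (T : ℕ) (i : V)
    (g : A i → ℝ) :
    ∫ h : Hist G A T, ∑ s, g ((h s).1 i) ∂(law π θ T T) = ∑ u, pulls π θ T ⟨i, u⟩ * g u := by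
  simp_rw [sum_decision_eq]
  rw [integral_finsetSum _ fun u _ => (integrable_count ..).mul_const _]
  simp_rw [integral_mul_const, pulls]

theorem integrable_sum_decision (π : LearningAlgorithm G A) (θ : V → Fin d → ℝ) (T : ℕ) (i : V)
    (g : A i → ℝ) : Integrable (fun h : Hist G A T => ∑ s, g ((h s).1 i)) (law π θ T T) := by
  simp_rw [sum_decision_eq]
  exact integrable_finsetSum _ fun u _ => (integrable_count ..).mul_const _

theorem sum_pulls (π : LearningAlgorithm G A) (θ : V → Fin d → ℝ) (T : ℕ) (i : V) :
    ∑ u, pulls π θ T ⟨i, u⟩ = T := by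
  have h := integral_sum_decision π θ T i (fun _ => 1)
  simpa using h.symm

theorem integral_sum_sum_decision (π : LearningAlgorithm G A) (θ : V → Fin d → ℝ) (T : ℕ)
    (N : Finset V) (g : (j : V) → A j → ℝ) :
    ∫ h : Hist G A T, ∑ s, ∑ j ∈ N, g j ((h s).1 j) ∂(law π θ T T) =
      ∑ j ∈ N, ∑ u, pulls π θ T ⟨j, u⟩ * g j u := by
  simp_rw [fun h : Hist G A T =>
    (Finset.sum_comm : ∑ s, ∑ j ∈ N, g j ((h s).1 j) = ∑ j ∈ N, ∑ s, g j ((h s).1 j))]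
  rw [integral_finsetSum _ fun j _ => integrable_sum_decision π θ T j (g j)]
  exact Finset.sum_congr rfl fun j _ => integral_sum_decision π θ T j (g j)

theorem regret_eq (π : LearningAlgorithm G A) (θ : V → Fin d → ℝ) (T : ℕ) :
    regret π θ T = ∑ a, pulls π θ T a * gap θ a := by
  rw [regret, integral_sum_sum_decision π θ T Finset.univ (fun i u => gap θ (⟨i, u⟩ : Arm A)),
    Fintype.sum_sigma]

theorem expGram_eq (π : LearningAlgorithm G A) (θ : V → Fin d → ℝ) (T : ℕ) (i : V) :
    expGram π θ T i = designMatrix G (pulls π θ T) i := by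
  ext k l
  simp only [expGram, gram, designMatrix, Matrix.of_apply, Matrix.sum_apply, Matrix.smul_apply,
    Matrix.vecMulVec_apply, smul_eq_mul]
  exact integral_sum_sum_decision π θ T (nbhd G i)
    (fun j u => (u : Fin d → ℝ) k * (u : Fin d → ℝ) l)

theorem wnormSq_designMatrix (α : Arm A → ℝ) (i : V) (δ : Fin d → ℝ) :
    wnormSq (designMatrix G α i) δ =
      ∑ j ∈ nbhd G i, ∑ u : A j, α ⟨j, u⟩ * ((u : Fin d → ℝ) ⬝ᵥ δ) ^ 2 := by
  simp only [wnormSq, designMatrix, Matrix.sum_mulVec, dotProduct_sum, Matrix.smul_mulVec,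
    dotProduct_smul, smul_eq_mul, Matrix.vecMulVec_mulVec]
  refine Finset.sum_congr rfl fun j _ => Finset.sum_congr rfl fun u _ => ?_
  rw [op_smul_eq_smul, dotProduct_comm δ, smul_eq_mul, sq]

/-- Moving only `θ i` affects only the links that end in `i`; by symmetry of the graph these start
at the neighbours of `i`. -/
theorem roundInfo_update [DecidableEq V] (θ : V → Fin d → ℝ) (i : V) (δ : Fin d → ℝ)
    (U : Action A) :
    roundInfo G θ (Function.update θ i (θ i + δ)) U =
      ∑ j ∈ nbhd G i, ((U j : Fin d → ℝ) ⬝ᵥ δ) ^ 2 := by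
  classical
  have h : ∀ q : V × V, ((U q.1 : Fin d → ℝ) ⬝ᵥ Function.update θ i (θ i + δ) q.2 -
      (U q.1 : Fin d → ℝ) ⬝ᵥ θ q.2) ^ 2 =
        if q.2 = i then ((U q.1 : Fin d → ℝ) ⬝ᵥ δ) ^ 2 else 0 := by
    rintro ⟨j, k⟩
    split_ifs with hk
    · simp only at hk; subst hk; simp [dotProduct_add]
    · simp [Function.update_of_ne hk]
  simp only [roundInfo, linkMean, h]
  rw [← Finset.sum_subtype (Finset.univ.filter fun q : V × V => Nbr G q.1 q.2) (by simp)
    (fun q : V × V => if q.2 = i then ((U q.1 : Fin d → ℝ) ⬝ᵥ δ) ^ 2 else 0), Finset.sum_filter,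
    Fintype.sum_prod_type, nbhd, Finset.sum_filter]
  refine Finset.sum_congr rfl fun j _ => ?_
  rw [Finset.sum_eq_single i (by intro k _ hk; simp [hk]) (by simp)]
  have : Nbr G j i ↔ Nbr G i j := by simp only [Nbr, G.adj_comm, eq_comm]
  simp [this]

theorem integral_info_update [DecidableEq V] (π : LearningAlgorithm G A) (θ : V → Fin d → ℝ)
    (T : ℕ) (i : V) (δ : Fin d → ℝ) :
    ∫ h, info θ (Function.update θ i (θ i + δ)) h ∂(law π θ T T) =
      wnormSq (expGram π θ T i) δ := by
  rw [expGram_eq, wnormSq_designMatrix]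
  simp only [info, roundInfo_update]
  exact integral_sum_sum_decision π θ T (nbhd G i) (fun j u => ((u : Fin d → ℝ) ⬝ᵥ δ) ^ 2)

/-- The test is the fraction `count / T` rather than the indicator of an event, so both errors are
expected pulls, which consistency controls directly. -/
theorem exp_neg_wnormSq_le [DecidableEq V] (π : LearningAlgorithm G A) (θ : V → Fin d → ℝ)
    {T : ℕ} (hT : 0 < T) (a : Arm A) (δ : Fin d → ℝ) :
    Real.exp (-1 - wnormSq (expGram π θ T a.1) δ / 2) ≤
      ((T - pulls π θ T a) + pulls π (Function.update θ a.1 (θ a.1 + δ)) T a) / T := by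
  have hT' : (0 : ℝ) < T := Nat.cast_pos.2 hT
  have h := exp_neg_info_le π θ (Function.update θ a.1 (θ a.1 + δ)) T T
    (f := fun h => count h a / T) ((measurable_count T a).div_const _)
    (fun h => div_nonneg (count_nonneg h a) hT'.le)
    (fun h => (div_le_one hT').2 (count_le h a))
  rw [integral_info_update] at h
  refine h.trans_eq ?_
  rw [integral_sub (integrable_const _) ((integrable_count ..).div_const _), integral_div,
    integral_div, ← pulls, ← pulls]
  simp
  field_simp

omit [Fintype V] in
theorem gap_nonneg (θ : V → Fin d → ℝ) (a : Arm A) : 0 ≤ gap θ a :=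
  sub_nonneg.2 (le_ciSup (f := fun v : A a.1 => (v : Fin d → ℝ) ⬝ᵥ θ a.1)
    (Set.finite_range _).bddAbove a.2)

omit [Fintype V] in
theorem gap_pos_of_lt (θ : V → Fin d → ℝ) (a : Arm A) (v : A a.1)
    (h : (a.2 : Fin d → ℝ) ⬝ᵥ θ a.1 < (v : Fin d → ℝ) ⬝ᵥ θ a.1) : 0 < gap θ a :=
  sub_pos.2 (h.trans_le (le_ciSup (f := fun v : A a.1 => (v : Fin d → ℝ) ⬝ᵥ θ a.1)
    (Set.finite_range _).bddAbove v))

omit [Fintype V] in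
theorem gap_eq_of_isMax (θ : V → Fin d → ℝ) (a : Arm A) (v : A a.1)
    (h : ∀ w ∈ A a.1, w ⬝ᵥ θ a.1 ≤ (v : Fin d → ℝ) ⬝ᵥ θ a.1) :
    gap θ a = ((v : Fin d → ℝ) - (a.2 : Fin d → ℝ)) ⬝ᵥ θ a.1 := by
  have : Nonempty (A a.1) := ⟨v⟩
  rw [gap, sub_dotProduct]
  congr 1
  exact le_antisymm (ciSup_le fun w => h w w.2)
    (le_ciSup (f := fun v : A a.1 => (v : Fin d → ℝ) ⬝ᵥ θ a.1) (Set.finite_range _).bddAbove v)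

theorem pulls_mul_gap_le (π : LearningAlgorithm G A) (θ : V → Fin d → ℝ) (T : ℕ) (a : Arm A) :
    pulls π θ T a * gap θ a ≤ regret π θ T := by
  rw [regret_eq]
  exact Finset.single_le_sum (f := fun a => pulls π θ T a * gap θ a)
    (fun a _ => mul_nonneg (pulls_nonneg ..) (gap_nonneg θ a)) (Finset.mem_univ a)

theorem regret_nonneg (π : LearningAlgorithm G A) (θ : V → Fin d → ℝ) (T : ℕ) :
    0 ≤ regret π θ T := by
  rw [regret_eq]
  exact Finset.sum_nonneg fun a _ => mul_nonneg (pulls_nonneg ..) (gap_nonneg θ a)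

theorem regret_eq_cost (π : LearningAlgorithm G A) (θ : V → Fin d → ℝ) (T : ℕ) :
    regret π θ T = cost θ (pulls π θ T) := by
  rw [regret_eq, cost, Finset.sum_filter]
  refine Finset.sum_congr rfl fun a _ => ?_
  split_ifs with h
  · rfl
  · rw [le_antisymm (not_lt.1 h) (gap_nonneg θ a), mul_zero]

/-- A consistent algorithm plays a suboptimal arm subpolynomially often. -/
theorem Consistent.pulls_isLittleO {π : LearningAlgorithm G A} (hπ : Consistent π)
    (θ : V → Fin d → ℝ) {a : Arm A} (ha : 0 < gap θ a) {p : ℝ} (hp : 0 < p) :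
    (fun T : ℕ => pulls π θ T a) =o[atTop] fun T : ℕ => (T : ℝ) ^ p := by
  refine Asymptotics.IsBigO.trans_isLittleO (.of_bound (gap θ a)⁻¹ (.of_forall fun T => ?_))
    (hπ θ p hp)
  rw [Real.norm_of_nonneg (pulls_nonneg ..), Real.norm_of_nonneg (regret_nonneg ..),
    le_inv_mul_iff₀ ha, mul_comm]
  exact pulls_mul_gap_le π θ T a

/-- The rounds not spent on `a` are spent on the other contexts of its node, all of which are
suboptimal. -/
theorem Consistent.sub_pulls_isLittleO {π : LearningAlgorithm G A} (hπ : Consistent π)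
    (θ : V → Fin d → ℝ) {a : Arm A} (ha : ∀ u, u ≠ a.2 → 0 < gap θ ⟨a.1, u⟩) {p : ℝ} (hp : 0 < p) :
    (fun T : ℕ => T - pulls π θ T a) =o[atTop] fun T : ℕ => (T : ℝ) ^ p := by
  classical
  have h : ∀ T : ℕ, T - pulls π θ T a =
      ∑ u ∈ Finset.univ.erase a.2, pulls π θ T ⟨a.1, u⟩ := fun T => by
    rw [← sum_pulls π θ T a.1, ← Finset.add_sum_erase _ _ (Finset.mem_univ a.2)]
    simp
  simp_rw [h]
  exact Asymptotics.IsLittleO.fun_sum fun u hu =>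
    hπ.pulls_isLittleO θ (ha u (Finset.ne_of_mem_erase hu)) hp

/-- Under a consistent algorithm, the Gram matrix of a node carries at least logarithmic
information about every parameter change that makes the optimal context of the node suboptimal. -/
theorem Consistent.eventually_le_wnormSq {π : LearningAlgorithm G A} (hπ : Consistent π)
    (θ : V → Fin d → ℝ) {a : Arm A} (ha : ∀ u, u ≠ a.2 → 0 < gap θ ⟨a.1, u⟩) {v : Fin d → ℝ}
    (hv : v ∈ A a.1) {δ : Fin d → ℝ} (hδ : 0 < (v - (a.2 : Fin d → ℝ)) ⬝ᵥ (θ a.1 + δ)) {c : ℝ}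
    (hc : c < 2) :
    ∀ᶠ T : ℕ in atTop, c * Real.log T ≤ wnormSq (expGram π θ T a.1) δ := by
  classical
  -- With `p = (2 - c) / 2`, the test error is at most `exp (-1) * T ^ p / T`; taking logarithms
  -- bounds the form below by `2 * (1 - p) * log T = c * log T`.
  have hp : 0 < (2 - c) / 2 := by linarith
  set θ' := Function.update θ a.1 (θ a.1 + δ) with hθ'
  have hgap : 0 < gap θ' a := by
    refine gap_pos_of_lt θ' a ⟨v, hv⟩ ?_
    rw [sub_dotProduct] at hδ
    simp only [hθ', Function.update_self]
    linarith
  have ho := (hπ.sub_pulls_isLittleO θ ha hp).add (hπ.pulls_isLittleO θ' hgap hp)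
  filter_upwards [ho.bound (Real.exp_pos (-1)), eventually_gt_atTop 0] with T h hT
  have hT' : (0 : ℝ) < T := Nat.cast_pos.2 hT
  have h1 := exp_neg_wnormSq_le π θ hT a δ
  have h2 : Real.exp (-1 - wnormSq (expGram π θ T a.1) δ / 2) ≤
      Real.exp (-1 + ((2 - c) / 2 * Real.log T - Real.log T)) := by
    refine h1.trans ?_
    rw [Real.exp_add, Real.exp_sub, Real.exp_log hT', mul_div_assoc', mul_comm _ (Real.log T),
      ← Real.rpow_def_of_pos hT']
    gcongr
    refine (Real.le_norm_self _).trans (h.trans_eq ?_)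
    rw [Real.norm_of_nonneg (Real.rpow_nonneg hT'.le _)]
  rw [Real.exp_le_exp] at h2
  linarith

end Counts

/-! ### Limits of quadratic forms whose coefficients may diverge. -/

section QuadraticForm

variable {d : ℕ} {ι : Type*} [Fintype ι]

/-- The quadratic form `δ ↦ ∑ a, m a * ⟨x a, δ⟩²`. -/
def qform (m : ι → ℝ) (x : ι → Fin d → ℝ) (δ : Fin d → ℝ) : ℝ :=
  ∑ a, m a * (x a ⬝ᵥ δ) ^ 2

theorem qform_smul (m : ι → ℝ) (x : ι → Fin d → ℝ) (c : ℝ) (δ : Fin d → ℝ) :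
    qform m x (c • δ) = c ^ 2 * qform m x δ := by
  simp only [qform, dotProduct_smul, smul_eq_mul, Finset.mul_sum]
  exact Finset.sum_congr rfl fun a _ => by ring

theorem le_qform {m : ι → ℝ} (hm : ∀ a, 0 ≤ m a) (x : ι → Fin d → ℝ) (δ : Fin d → ℝ) (a : ι) :
    m a * (x a ⬝ᵥ δ) ^ 2 ≤ qform m x δ :=
  Finset.single_le_sum (f := fun a => m a * (x a ⬝ᵥ δ) ^ 2)
    (fun a _ => mul_nonneg (hm a) (sq_nonneg _)) (Finset.mem_univ a)

theorem _root_.Ultrafilter.exists_tendsto_of_norm_le {α E : Type*} [NormedAddCommGroup E]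
    [ProperSpace E] (𝓕 : Ultrafilter α) {w : α → E} {C : ℝ} (h : ∀ᶠ T in 𝓕, ‖w T‖ ≤ C) :
    ∃ w₀, Tendsto w 𝓕 (𝓝 w₀) := by
  obtain ⟨w₀, -, hw⟩ := (isCompact_closedBall (0 : E) C).ultrafilter_le_nhds' (𝓕.map w)
    (h.mono fun T hT => by simpa using hT)
  exact ⟨w₀, hw⟩

/-- This dichotomy takes the place of passing to subsequences, separately for each coefficient. -/
theorem _root_.Ultrafilter.tendsto_atTop_or_nhds {α : Type*} (𝓕 : Ultrafilter α) {f : α → ℝ}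
    (h0 : ∀ T, 0 ≤ f T) : Tendsto f 𝓕 atTop ∨ ∃ c, Tendsto f 𝓕 (𝓝 c) := by
  by_cases h : ∃ C, ∀ᶠ T in 𝓕, f T ≤ C
  · obtain ⟨C, hC⟩ := h
    exact .inr (𝓕.exists_tendsto_of_norm_le (C := C) (hC.mono fun T hT => by
      rwa [Real.norm_of_nonneg (h0 T)]))
  · push Not at h
    refine .inl (tendsto_atTop.2 fun C => ?_)
    exact (h C).mono fun T hT => hT.le

/-- If the values of the forms stay bounded along a convergent sequence of vectors, then a vector
whose coefficient tends to infinity is orthogonal to the limit. -/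
theorem dotProduct_eq_zero_of_tendsto_atTop {α : Type*} {𝓕 : Ultrafilter α} {m : α → ι → ℝ}
    (hm : ∀ T a, 0 ≤ m T a) (x : ι → Fin d → ℝ) {w : α → Fin d → ℝ} {w₀ : Fin d → ℝ}
    (hw : Tendsto w 𝓕 (𝓝 w₀)) {B : ℝ} (hB : ∀ᶠ T in 𝓕, qform (m T) x (w T) ≤ B) {a : ι}
    (ha : Tendsto (fun T => m T a) 𝓕 atTop) : x a ⬝ᵥ w₀ = 0 := by
  have h1 : Tendsto (fun T => (x a ⬝ᵥ w T) ^ 2) 𝓕 (𝓝 ((x a ⬝ᵥ w₀) ^ 2)) :=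
    (((by fun_prop : Continuous fun y : Fin d → ℝ => (x a ⬝ᵥ y) ^ 2)).tendsto w₀).comp hw
  have h2 : Tendsto (fun T => B / m T a) 𝓕 (𝓝 0) := ha.const_div_atTop B
  have h3 : (x a ⬝ᵥ w₀) ^ 2 ≤ 0 := by
    refine le_of_tendsto_of_tendsto h1 h2 ?_
    filter_upwards [hB, ha.eventually_gt_atTop 0] with T h h'
    rw [le_div_iff₀ h', mul_comm]
    exact (le_qform (hm T) x _ a).trans h
  exact pow_eq_zero_iff two_ne_zero |>.1 (le_antisymm h3 (sq_nonneg _))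

/-- Compare term by term. If a coefficient diverges, its vector is orthogonal to the limit and its
term vanishes there; if it converges, its term changes by an amount tending to zero. -/
theorem eventually_qform_limit_le {α : Type*} {𝓕 : Ultrafilter α} {m : α → ι → ℝ}
    (hm : ∀ T a, 0 ≤ m T a) (x : ι → Fin d → ℝ) {w : α → Fin d → ℝ} {w₀ : Fin d → ℝ}
    (hw : Tendsto w 𝓕 (𝓝 w₀)) {B : ℝ} (hB : ∀ᶠ T in 𝓕, qform (m T) x (w T) ≤ B) {B' : ℝ}
    (hBB : B < B') : ∀ᶠ T in 𝓕, qform (m T) x w₀ ≤ B' := by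
  -- The `+ 1` keeps the denominator positive when `ι` is empty.
  set ε := (B' - B) / (Fintype.card ι + 1) with hε
  have hε0 : 0 < ε := div_pos (sub_pos.2 hBB) (by positivity)
  have hterm : ∀ a, ∀ᶠ T in 𝓕, m T a * (x a ⬝ᵥ w₀) ^ 2 ≤ m T a * (x a ⬝ᵥ w T) ^ 2 + ε := by
    intro a
    rcases 𝓕.tendsto_atTop_or_nhds (fun T => hm T a) with ha | ⟨c, hc⟩
    · rw [dotProduct_eq_zero_of_tendsto_atTop hm x hw hB ha]
      refine .of_forall fun T => ?_
      have := mul_nonneg (hm T a) (sq_nonneg (x a ⬝ᵥ w T))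
      simp only [ne_eq, OfNat.ofNat_ne_zero, not_false_eq_true, zero_pow, mul_zero]
      linarith
    · have h1 : Tendsto (fun T => (x a ⬝ᵥ w T) ^ 2) 𝓕 (𝓝 ((x a ⬝ᵥ w₀) ^ 2)) :=
        (((by fun_prop : Continuous fun y : Fin d → ℝ => (x a ⬝ᵥ y) ^ 2)).tendsto w₀).comp hw
      have h2 := (hc.mul_const ((x a ⬝ᵥ w₀) ^ 2)).sub (hc.mul h1)
      rw [sub_self] at h2
      filter_upwards [h2.eventually_le_const hε0] with T hT
      linarith
  filter_upwards [hB, eventually_all.2 hterm] with T h1 h2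
  calc qform (m T) x w₀ ≤ ∑ a, (m T a * (x a ⬝ᵥ w T) ^ 2 + ε) := Finset.sum_le_sum fun a _ => h2 a
    _ = qform (m T) x (w T) + Fintype.card ι * ε := by
      rw [Finset.sum_add_distrib, qform]; simp
    _ ≤ B + (B' - B) := by
      have : Fintype.card ι * ε ≤ B' - B := by
        rw [hε, mul_div_assoc', div_le_iff₀ (by positivity)]
        nlinarith
      linarith
    _ = B' := by ring

/-- A sequence of choices witnessing a frequent event, together with an ultrafilter along which
the choices are good. -/
theorem exists_ultrafilter_of_frequently {α β : Type*} [Nonempty β] {l : Filter α}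
    {P : α → β → Prop} (h : ∃ᶠ T in l, ∃ y, P T y) :
    ∃ (𝓕 : Ultrafilter α) (w : α → β), (𝓕 : Filter α) ≤ l ∧ ∀ᶠ T in 𝓕, P T (w T) := by
  have hne : (l ⊓ 𝓟 {T | ∃ y, P T y}).NeBot := frequently_mem_iff_neBot.1 h
  have hc : ∀ T, ∃ y, (∃ z, P T z) → P T y := fun T => by
    by_cases hT : ∃ z, P T z
    · exact ⟨hT.choose, fun _ => hT.choose_spec⟩
    · exact ⟨Classical.arbitrary β, fun hz => absurd hz hT⟩
  choose w hw using hc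
  have hle := Ultrafilter.of_le (l ⊓ 𝓟 {T | ∃ y, P T y})
  exact ⟨Ultrafilter.of _, w, hle.trans inf_le_left,
    Filter.mem_of_superset (hle (mem_inf_of_right (mem_principal_self _))) fun T hT => hw T hT⟩

/-! ### From a bound for each fixed direction to a uniform bound. -/

section Uniform

variable {m : ℕ → ι → ℝ} {x : ι → Fin d → ℝ} {S : Set (Fin d → ℝ)} {θ : Fin d → ℝ} {a₀ : ι}

/-- Along any ultrafilter, the forms do not degenerate at a nonzero limit of directions on which
they are bounded. -/
theorem not_eventually_qform_small (hm : ∀ T a, 0 ≤ m T a) (hS : Submodule.span ℝ S = ⊤)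
    (hstar : Tendsto (fun T => m T a₀) atTop atTop)
    (hpt : ∀ v ∈ S, ∀ δ, 0 < (v - x a₀) ⬝ᵥ (θ + δ) → ∀ c < 2, ∀ᶠ T in atTop, c ≤ qform (m T) x δ)
    {𝓕 : Ultrafilter ℕ} (h𝓕 : (𝓕 : Filter ℕ) ≤ atTop) {w₀ : Fin d → ℝ} (hw₀ : w₀ ≠ 0) :
    ¬ ∀ B > 0, ∀ᶠ T in 𝓕, qform (m T) x w₀ ≤ B := by
  intro hsmall
  have h0 : x a₀ ⬝ᵥ w₀ = 0 := dotProduct_eq_zero_of_tendsto_atTop hm x tendsto_const_nhds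
    (hsmall 1 one_pos) (hstar.mono_left h𝓕)
  obtain ⟨v, hv, hvw⟩ : ∃ v ∈ S, v ⬝ᵥ w₀ ≠ 0 := by
    by_contra! hcon
    refine hw₀ (dotProduct_eq_zero w₀ fun y => ?_)
    have hy : y ∈ Submodule.span ℝ S := hS ▸ Submodule.mem_top
    rw [dotProduct_comm]
    induction hy using Submodule.span_induction with
    | mem y hy => exact hcon y hy
    | zero => simp
    | add y z _ _ hy hz => simp [add_dotProduct, hy, hz]
    | smul c y _ hy => simp [smul_dotProduct, hy]
  -- Chosen so that the perturbation `s • w₀` makes `v` beat `x a₀` by exactly `1`. The pointwise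
  -- bound with `c = 1` then contradicts smallness of the form; the threshold `1 / (s ^ 2 + 1)` also
  -- covers `s = 0`.
  set s : ℝ := (1 - (v - x a₀) ⬝ᵥ θ) / (v ⬝ᵥ w₀) with hs
  have hpos : 0 < (v - x a₀) ⬝ᵥ (θ + s • w₀) := by
    rw [dotProduct_add, dotProduct_smul, sub_dotProduct v (x a₀) w₀, h0, sub_zero, hs, smul_eq_mul,
      div_mul_cancel₀ _ hvw]
    linarith
  have h1 := (hpt v hv _ hpos 1 (by norm_num)).filter_mono h𝓕
  have h2 := hsmall (1 / (s ^ 2 + 1)) (by positivity)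
  obtain ⟨T, hT1, hT2⟩ := (h1.and h2).exists
  rw [qform_smul] at hT1
  have h3 : s ^ 2 * qform (m T) x w₀ ≤ s ^ 2 * (1 / (s ^ 2 + 1)) := by gcongr
  have h4 : s ^ 2 * (1 / (s ^ 2 + 1)) < 1 := by
    rw [mul_one_div, div_lt_one (by positivity)]; linarith
  linarith

/-- Otherwise, unit vectors on which the forms are nonpositive would have a unit limit at which the
forms become arbitrarily small. -/
theorem eventually_qform_pos (hm : ∀ T a, 0 ≤ m T a) (hS : Submodule.span ℝ S = ⊤)
    (hstar : Tendsto (fun T => m T a₀) atTop atTop)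
    (hpt : ∀ v ∈ S, ∀ δ, 0 < (v - x a₀) ⬝ᵥ (θ + δ) → ∀ c < 2, ∀ᶠ T in atTop,
      c ≤ qform (m T) x δ) :
    ∀ᶠ T in atTop, ∀ w ≠ 0, 0 < qform (m T) x w := by
  by_contra hcon
  have hcon' : ∃ᶠ T in atTop, ∃ w : Fin d → ℝ, ‖w‖ = 1 ∧ qform (m T) x w ≤ 0 := by
    refine (not_eventually.1 hcon).mono fun T hT => ?_
    push Not at hT
    obtain ⟨w, hw, hq⟩ := hT
    refine ⟨‖w‖⁻¹ • w, by
      rw [norm_smul, norm_inv, norm_norm, inv_mul_cancel₀ (norm_ne_zero_iff.2 hw)], ?_⟩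
    rw [qform_smul]
    exact mul_nonpos_of_nonneg_of_nonpos (sq_nonneg _) hq
  obtain ⟨𝓕, w, h𝓕, hw⟩ := exists_ultrafilter_of_frequently hcon'
  obtain ⟨w₀, hlim⟩ := 𝓕.exists_tendsto_of_norm_le (hw.mono fun T hT => hT.1.le)
  have hnorm : ‖w₀‖ = 1 := tendsto_nhds_unique hlim.norm
    (tendsto_const_nhds.congr' (hw.mono fun T hT => hT.1.symm))
  refine not_eventually_qform_small hm hS hstar hpt h𝓕 (w₀ := w₀) ?_ fun B hB =>
    eventually_qform_limit_le hm x hlim (hw.mono fun T hT => hT.2) hB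
  rintro rfl
  simp at hnorm

/-- The order of quantifiers is the point: `hpt` lets the threshold for `T` depend on `δ`, whereas
here one threshold serves the whole unbounded hyperplane. -/
theorem eventually_le_qform (hm : ∀ T a, 0 ≤ m T a) (hS : Submodule.span ℝ S = ⊤)
    (hstar : Tendsto (fun T => m T a₀) atTop atTop)
    (hpt : ∀ v ∈ S, ∀ δ, 0 < (v - x a₀) ⬝ᵥ (θ + δ) → ∀ c < 2, ∀ᶠ T in atTop, c ≤ qform (m T) x δ)
    {u : Fin d → ℝ} (hu : u ∈ S) {Δ : ℝ} (hΔ : (x a₀ - u) ⬝ᵥ θ = Δ) (hΔ0 : 0 < Δ) {b : ℝ}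
    (hb : Δ ^ 2 / 2 < b) :
    ∀ᶠ T in atTop, ∀ δ, u ⬝ᵥ δ = 1 → 1 / b ≤ qform (m T) x δ := by
  have hb0 : 0 < b := lt_of_le_of_lt (by positivity) hb
  by_contra hcon
  have hcon' : ∃ᶠ T in atTop, ∃ δ : Fin d → ℝ, u ⬝ᵥ δ = 1 ∧ qform (m T) x δ < 1 / b := by
    refine (not_eventually.1 hcon).mono fun T hT => ?_
    push Not at hT
    exact hT
  obtain ⟨𝓕, δ, h𝓕, hδ⟩ := exists_ultrafilter_of_frequently hcon'
  -- The violating `δ T` may be unbounded. With this scaling both `r T` and `r T • δ T` stay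
  -- bounded, and their limits satisfy `r₀ + ‖w₀‖ = 1`, so they cannot both vanish.
  set r : ℕ → ℝ := fun T => (1 + ‖δ T‖)⁻¹ with hr
  have hr0 : ∀ T, 0 < r T := fun T => by positivity
  have hr1 : ∀ T, r T + r T * ‖δ T‖ = 1 := fun T => by
    simp only [hr]; field_simp
  obtain ⟨r₀, hrlim⟩ := 𝓕.exists_tendsto_of_norm_le (w := r) (C := 1) (.of_forall fun T => by
    rw [Real.norm_of_nonneg (hr0 T).le]
    nlinarith [hr1 T, hr0 T, norm_nonneg (δ T)])
  obtain ⟨w₀, hwlim⟩ := 𝓕.exists_tendsto_of_norm_le (w := fun T => r T • δ T) (C := 1)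
    (.of_forall fun T => by
      rw [norm_smul, Real.norm_of_nonneg (hr0 T).le]
      linarith [hr1 T, hr0 T])
  have hr₀ : 0 ≤ r₀ := ge_of_tendsto' hrlim fun T => (hr0 T).le
  have hnorm : r₀ + ‖w₀‖ = 1 := by
    refine tendsto_nhds_unique (hrlim.add hwlim.norm) ?_
    refine tendsto_const_nhds.congr fun T => ?_
    rw [norm_smul, Real.norm_of_nonneg (hr0 T).le, hr1]
  have huw : u ⬝ᵥ w₀ = r₀ := by
    refine tendsto_nhds_unique ((((by fun_prop :
      Continuous fun y : Fin d → ℝ => u ⬝ᵥ y)).tendsto w₀).comp hwlim) (hrlim.congr' ?_)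
    filter_upwards [hδ] with T hT
    simp [hT.1]
  have hq : ∀ B > r₀ ^ 2 / b, ∀ᶠ T in 𝓕, qform (m T) x w₀ ≤ B := by
    intro B hB
    obtain ⟨B₁, h1, h2⟩ := exists_between hB
    refine eventually_qform_limit_le hm x hwlim ?_ h2
    filter_upwards [hδ, ((hrlim.pow 2).div_const b).eventually_le_const h1] with T hT hT'
    rw [qform_smul]
    refine le_trans ?_ hT'
    rw [div_eq_mul_one_div]
    exact mul_le_mul_of_nonneg_left hT.2.le (sq_nonneg _)
  -- If `r₀ = 0`, the violating vectors escape to infinity and the forms degenerate at the unit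
  -- vector `w₀`, which is excluded.
  have hr₀0 : 0 < r₀ := by
    refine lt_of_le_of_ne hr₀ fun h => ?_
    rw [← h] at hnorm hq
    refine not_eventually_qform_small hm hS hstar hpt h𝓕 (w₀ := w₀) ?_ (by simpa using hq)
    rintro rfl
    simp at hnorm
  have h0 : x a₀ ⬝ᵥ w₀ = 0 := dotProduct_eq_zero_of_tendsto_atTop hm x tendsto_const_nhds
    (hq (r₀ ^ 2 / b + 1) (lt_add_one _)) (hstar.mono_left h𝓕)
  have hroot : Δ < √(2 * b) := Real.lt_sqrt_of_sq_lt (by linarith)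
  -- The vector `w₀ / r₀` lies on the hyperplane and is orthogonal to `x a₀`. Stretched by `s > Δ`
  -- it makes `u` overtake `x a₀`, while `s < √(2 * b)` keeps the form below `c < c' < 2`, against
  -- the pointwise bound with `c'`.
  obtain ⟨s, hs1, hs2⟩ := exists_between hroot
  have hs0 : 0 < s := hΔ0.trans hs1
  have hsb : s ^ 2 / b < 2 := by
    rw [div_lt_iff₀ hb0]
    exact (Real.lt_sqrt hs0.le).1 hs2
  obtain ⟨c, hc1, hc2⟩ := exists_between hsb
  obtain ⟨c', hc1', hc2'⟩ := exists_between hc2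
  have hpos : 0 < (u - x a₀) ⬝ᵥ (θ + (s / r₀) • w₀) := by
    rw [← neg_sub, neg_dotProduct, dotProduct_add, hΔ, dotProduct_smul, sub_dotProduct, h0, huw,
      smul_eq_mul, zero_sub, mul_neg, div_mul_cancel₀ _ hr₀0.ne']
    linarith
  have h1 := (hpt u hu _ hpos c' hc2').filter_mono h𝓕
  have h2 := hq (r₀ ^ 2 / s ^ 2 * c) (by
    have : r₀ ^ 2 / b = r₀ ^ 2 / s ^ 2 * (s ^ 2 / b) := by field_simp
    rw [this]
    gcongr)
  obtain ⟨T, hT1, hT2⟩ := (h1.and h2).exists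
  rw [qform_smul] at hT1
  have h3 : (s / r₀) ^ 2 * qform (m T) x w₀ ≤ (s / r₀) ^ 2 * (r₀ ^ 2 / s ^ 2 * c) := by gcongr
  have h4 : (s / r₀) ^ 2 * (r₀ ^ 2 / s ^ 2 * c) = c := by field_simp
  linarith

end Uniform

end QuadraticForm

/-! ### Application to the expected Gram matrix and to the optimization problem. -/

section Main

variable {V : Type*} [Fintype V] {d : ℕ} {G : SimpleGraph V} {A : V → Finset (Fin d → ℝ)}

open Classical in
/-- The coefficients of the arms in the expected Gram matrix of a node, divided by `log T`. -/
noncomputable def weight (π : LearningAlgorithm G A) (θ : V → Fin d → ℝ) (i : V) (T : ℕ)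
    (a : Arm A) : ℝ :=
  (if a.1 ∈ nbhd G i then pulls π θ T a else 0) / Real.log T

theorem weight_nonneg (π : LearningAlgorithm G A) (θ : V → Fin d → ℝ) (i : V) (T : ℕ)
    (a : Arm A) : 0 ≤ weight π θ i T a := by
  refine div_nonneg ?_ (Real.log_natCast_nonneg T)
  split_ifs
  exacts [pulls_nonneg .., le_rfl]

theorem qform_weight (π : LearningAlgorithm G A) (θ : V → Fin d → ℝ) (i : V) (T : ℕ)
    (δ : Fin d → ℝ) :
    qform (weight π θ i T) (fun a => (a.2 : Fin d → ℝ)) δ =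
      wnormSq (expGram π θ T i) δ / Real.log T := by
  rw [expGram_eq, wnormSq_designMatrix, qform, Fintype.sum_sigma, Finset.sum_div]
  rw [← Finset.sum_subset (Finset.subset_univ (nbhd G i))]
  · refine Finset.sum_congr rfl fun j hj => ?_
    rw [Finset.sum_div]
    refine Finset.sum_congr rfl fun u _ => ?_
    simp only [weight, if_pos hj]
    ring
  · intro j _ hj
    exact Finset.sum_eq_zero fun u _ => by simp [weight, hj]

theorem isHermitian_designMatrix (α : Arm A → ℝ) (i : V) :
    (designMatrix G α i).IsHermitian := by
  ext k l
  simp only [designMatrix, Matrix.conjTranspose_apply, Matrix.sum_apply, Matrix.smul_apply,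
    Matrix.vecMulVec_apply, smul_eq_mul, star_trivial]
  exact Finset.sum_congr rfl fun j _ => Finset.sum_congr rfl fun u _ => by ring

theorem designMatrix_smul (c : ℝ) (α : Arm A → ℝ) (i : V) :
    designMatrix G (c • α) i = c • designMatrix G α i := by
  simp only [designMatrix, Finset.smul_sum, Pi.smul_apply, smul_assoc]

theorem cost_smul (θ : V → Fin d → ℝ) (c : ℝ) (α : Arm A → ℝ) :
    cost θ (c • α) = c * cost θ α := by
  simp only [cost, Finset.mul_sum, Pi.smul_apply, smul_eq_mul, mul_assoc]

theorem wnormSq_inv_smul {M : Matrix (Fin d) (Fin d) ℝ} (hM : M.PosDef) {c : ℝ} (hc : c ≠ 0)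
    (u : Fin d → ℝ) : wnormSq (c • M)⁻¹ u = c⁻¹ * wnormSq M⁻¹ u := by
  have : Invertible c := invertibleOfNonzero hc
  rw [Matrix.inv_smul M c ((Matrix.isUnit_iff_isUnit_det M).1 hM.isUnit), wnormSq, wnormSq,
    Matrix.smul_mulVec, dotProduct_smul, smul_eq_mul, invOf_eq_inv]

/-- The minimizer on the hyperplane is `M⁻¹ u` divided by `N`, where the form equals `1 / N`.
Treating `N ≤ 0` apart disposes of `u = 0`. -/
theorem wnormSq_inv_le_of_forall {M : Matrix (Fin d) (Fin d) ℝ} (hM : M.PosDef) {u : Fin d → ℝ}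
    {b : ℝ} (hb : 0 < b) (h : ∀ δ, u ⬝ᵥ δ = 1 → 1 / b ≤ wnormSq M δ) : wnormSq M⁻¹ u ≤ b := by
  set N := wnormSq M⁻¹ u with hN
  rcases le_or_gt N 0 with h0 | h0
  · exact h0.trans hb.le
  have h1 := h (N⁻¹ • M⁻¹.mulVec u) (by
    rw [dotProduct_smul, smul_eq_mul]; exact inv_mul_cancel₀ h0.ne')
  have h2 : wnormSq M (N⁻¹ • M⁻¹.mulVec u) = 1 / N := by
    rw [wnormSq, Matrix.mulVec_smul, Matrix.mulVec_mulVec,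
      Matrix.mul_nonsing_inv _ ((Matrix.isUnit_iff_isUnit_det M).1 hM.isUnit), Matrix.one_mulVec,
      dotProduct_smul, smul_dotProduct, dotProduct_comm, smul_eq_mul, smul_eq_mul]
    change N⁻¹ * (N⁻¹ * N) = _
    rw [inv_mul_cancel₀ h0.ne', mul_one, one_div]
  rw [h2] at h1
  exact (one_div_le_one_div hb h0).1 h1

theorem tendsto_natCast_div_log : Tendsto (fun T : ℕ => (T : ℝ) / Real.log T) atTop atTop := by
  have h1 : Tendsto (fun x : ℝ => Real.log x / x) atTop (𝓝[>] 0) := by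
    refine tendsto_nhdsWithin_iff.2 ⟨Real.isLittleO_log_id_atTop.tendsto_div_nhds_zero, ?_⟩
    filter_upwards [eventually_gt_atTop 1] with x hx
    exact div_pos (Real.log_pos hx) (by linarith)
  refine ((tendsto_inv_nhdsGT_zero.comp h1).comp tendsto_natCast_atTop_atTop).congr fun T => ?_
  simp

theorem eventually_log_pos : ∀ᶠ T : ℕ in atTop, 0 < Real.log T := by
  filter_upwards [eventually_gt_atTop 1] with T hT
  exact Real.log_pos (by exact_mod_cast hT)

section Consistent

variable {π : LearningAlgorithm G A} {θ : V → Fin d → ℝ} {a : Arm A}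

/-- The unique optimal arm is eventually played at least `T / 2` times in expectation. -/
theorem Consistent.tendsto_weight (hπ : Consistent π)
    (ha : ∀ u, u ≠ a.2 → 0 < gap θ ⟨a.1, u⟩) :
    Tendsto (fun T => weight π θ a.1 T a) atTop atTop := by
  have h1 := (hπ.sub_pulls_isLittleO θ ha one_pos).bound (c := 1 / 2) (by norm_num)
  refine tendsto_atTop_mono' _ ?_ (tendsto_natCast_div_log.const_mul_atTop (r := 1 / 2)
    (by norm_num))
  filter_upwards [h1, eventually_log_pos] with T hT hlog
  have hmem : a.1 ∈ nbhd G a.1 := by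
    classical exact Finset.mem_filter.2 ⟨Finset.mem_univ _, .inl rfl⟩
  rw [weight, if_pos hmem, mul_div_assoc']
  gcongr
  rw [Real.rpow_one, Real.norm_of_nonneg (Nat.cast_nonneg T)] at hT
  have := Real.le_norm_self (T - pulls π θ T a)
  linarith

theorem Consistent.eventually_le_qform_weight (hπ : Consistent π)
    (ha : ∀ u, u ≠ a.2 → 0 < gap θ ⟨a.1, u⟩) :
    ∀ v ∈ (A a.1 : Set (Fin d → ℝ)), ∀ δ, 0 < (v - (a.2 : Fin d → ℝ)) ⬝ᵥ (θ a.1 + δ) →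
      ∀ c < 2, ∀ᶠ T in atTop,
        c ≤ qform (weight π θ a.1 T) (fun a => (a.2 : Fin d → ℝ)) δ := by
  intro v hv δ hδ c hc
  filter_upwards [hπ.eventually_le_wnormSq θ ha hv hδ hc, eventually_log_pos] with T hT hlog
  rwa [qform_weight, le_div_iff₀ hlog]

theorem Consistent.eventually_posDef (hπ : Consistent π)
    (hspan : Submodule.span ℝ (A a.1 : Set (Fin d → ℝ)) = ⊤)
    (ha : ∀ u, u ≠ a.2 → 0 < gap θ ⟨a.1, u⟩) :
    ∀ᶠ T in atTop, (expGram π θ T a.1).PosDef := by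
  filter_upwards [eventually_qform_pos (x := fun a : Arm A => (a.2 : Fin d → ℝ))
    (weight_nonneg π θ a.1) hspan (hπ.tendsto_weight ha) (hπ.eventually_le_qform_weight ha),
    eventually_log_pos] with T hT hlog
  refine Matrix.PosDef.of_dotProduct_mulVec_pos ?_ fun w hw => ?_
  · rw [expGram_eq]; exact isHermitian_designMatrix _ _
  · have h := hT w hw
    rw [qform_weight] at h
    exact (div_pos_iff_of_pos_right hlog).1 h

theorem Consistent.eventually_log_mul_wnormSq_le (hπ : Consistent π)
    (hspan : Submodule.span ℝ (A a.1 : Set (Fin d → ℝ)) = ⊤)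
    (ha : ∀ u, u ≠ a.2 → 0 < gap θ ⟨a.1, u⟩)
    (hmax : ∀ w ∈ A a.1, w ⬝ᵥ θ a.1 ≤ (a.2 : Fin d → ℝ) ⬝ᵥ θ a.1) {u : A a.1}
    (hu : 0 < gap θ ⟨a.1, u⟩) {b : ℝ} (hb : gap θ ⟨a.1, u⟩ ^ 2 / 2 < b) :
    ∀ᶠ T : ℕ in atTop, Real.log T * wnormSq (expGram π θ T a.1)⁻¹ (u : Fin d → ℝ) ≤ b := by
  have hb0 : 0 < b := lt_of_le_of_lt (by positivity) hb
  filter_upwards [eventually_le_qform (x := fun a : Arm A => (a.2 : Fin d → ℝ))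
    (weight_nonneg π θ a.1) hspan (hπ.tendsto_weight ha) (hπ.eventually_le_qform_weight ha) u.2
    (gap_eq_of_isMax θ ⟨a.1, u⟩ a.2 hmax).symm hu hb,
    eventually_log_pos, hπ.eventually_posDef hspan ha] with T hT hlog hpd
  rw [← le_div_iff₀' hlog]
  refine wnormSq_inv_le_of_forall hpd (div_pos hb0 hlog) fun δ hδ => ?_
  have h := hT δ hδ
  rw [qform_weight, le_div_iff₀ hlog] at h
  rw [one_div_div]
  exact (le_of_eq (by ring)).trans h

end Consistent

/-- The norm constraints hold only up to an arbitrarily small slack. Scaling the pulls by `c / log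
T` with `c > 1` divides the inverse norms by `c` and absorbs it, as suboptimal gaps are positive;
then `c` is brought close to `1`. -/
theorem optValue_le_of_forall {π : LearningAlgorithm G A} {θ : V → Fin d → ℝ}
    (hpd : ∀ a ∈ subopt A θ, ∀ᶠ T in atTop, (expGram π θ T a.1).PosDef)
    (hle : ∀ a ∈ subopt A θ, ∀ b > gap θ a ^ 2 / 2, ∀ᶠ T : ℕ in atTop,
      Real.log T * wnormSq (expGram π θ T a.1)⁻¹ (a.2 : Fin d → ℝ) ≤ b) :
    optValue G A θ ≤
      limsup (fun T : ℕ => ((regret π θ T / Real.log T : ℝ) : EReal)) atTop := by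
  have key : ∀ c > (1 : ℝ), ∀ᶠ T : ℕ in atTop,
      optValue G A θ ≤ ((c * (regret π θ T / Real.log T) : ℝ) : EReal) := by
    intro c hc
    have hc0 : 0 < c := one_pos.trans hc
    have h1 : ∀ᶠ T : ℕ in atTop, ∀ a : Arm A, a ∈ subopt A θ → (expGram π θ T a.1).PosDef ∧
        Real.log T * wnormSq (expGram π θ T a.1)⁻¹ (a.2 : Fin d → ℝ) ≤ c * (gap θ a ^ 2 / 2) := by
      refine eventually_all.2 fun a => ?_
      by_cases ha : a ∈ subopt A θ
      · have hgap : 0 < gap θ a := ha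
        filter_upwards [hpd a ha, hle a ha (c * (gap θ a ^ 2 / 2))
          (lt_mul_of_one_lt_left (by positivity) hc)] with T h1 h2 _ using ⟨h1, h2⟩
      · exact .of_forall fun T h => absurd h ha
    filter_upwards [h1, eventually_log_pos] with T hT hlog
    have hcl : 0 < c / Real.log T := div_pos hc0 hlog
    have hmem : (c / Real.log T) • pulls π θ T ∈ feasible G A θ := by
      refine ⟨fun a => mul_nonneg hcl.le (pulls_nonneg ..), fun a ha => ?_⟩
      obtain ⟨h2, h3⟩ := hT a ha
      rw [designMatrix_smul, ← expGram_eq, wnormSq_inv_smul h2 hcl.ne']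
      refine ⟨h2.smul hcl, ?_⟩
      rw [inv_div, div_mul_eq_mul_div, div_le_iff₀ hc0, mul_comm _ c]
      exact h3
    refine (iInf₂_le _ hmem).trans_eq ?_
    rw [cost_smul, ← regret_eq_cost]
    congr 1
    ring
  by_contra! hcon
  obtain ⟨r, hr1, hr2⟩ := EReal.lt_iff_exists_real_btwn.1 hcon
  have hev := eventually_lt_of_limsup_lt hr1
  have hr0 : 0 ≤ r := by
    obtain ⟨T, hT1⟩ := hev.exists
    have := EReal.coe_lt_coe_iff.1 hT1
    exact (div_nonneg (regret_nonneg π θ T) (Real.log_natCast_nonneg T)).trans this.le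
  obtain ⟨q, hq1, hq2⟩ := EReal.lt_iff_exists_real_btwn.1 hr2
  have hrq : r < q := EReal.coe_lt_coe_iff.1 hq1
  have hq0 : 0 < q := hr0.trans_lt hrq
  -- Both `1 < c` and `c * r ≤ q` follow from `0 ≤ r < q`; the shift by `1` allows `r = 0`.
  set c := (q + 1) / (r + 1) with hcdef
  have hc : 1 < c := by rw [hcdef, one_lt_div (by linarith)]; linarith
  obtain ⟨T, hT1, hT2⟩ := ((key c hc).and hev).exists
  have h1 := EReal.coe_lt_coe_iff.1 hT2
  have h2 : c * (regret π θ T / Real.log T) ≤ q := by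
    have h3 : c * (regret π θ T / Real.log T) ≤ c * r := by gcongr
    refine h3.trans ?_
    rw [hcdef, div_mul_eq_mul_div, div_le_iff₀ (by linarith)]
    nlinarith
  exact absurd (hT1.trans (EReal.coe_le_coe_iff.2 h2)) (not_le.2 hq2)

end Main

end GraphBandit

theorem theorem1 {V : Type*} [Fintype V] {d : ℕ} (G : SimpleGraph V)
    (A : V → Finset (Fin d → ℝ))
    (hspan : ∀ i, Submodule.span ℝ (A i : Set (Fin d → ℝ)) = ⊤)
    (π : GraphBandit.LearningAlgorithm G A) (hπ : GraphBandit.Consistent π)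
    (θ : V → Fin d → ℝ)
    (hopt : ∀ i, ∃! u : Fin d → ℝ, u ∈ A i ∧ ∀ v ∈ A i, v ⬝ᵥ θ i ≤ u ⬝ᵥ θ i) :
    (∀ i, ∀ᶠ T : ℕ in atTop, (GraphBandit.expGram π θ T i).PosDef) ∧
    (∀ a ∈ GraphBandit.subopt A θ,
      limsup (fun T : ℕ => ((Real.log T *
          GraphBandit.wnormSq (GraphBandit.expGram π θ T a.1)⁻¹ (a.2 : Fin d → ℝ) : ℝ) : EReal))
        atTop ≤ ((GraphBandit.gap θ a ^ 2 / 2 : ℝ) : EReal)) ∧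
    GraphBandit.optValue G A θ ≤
      limsup (fun T : ℕ => ((GraphBandit.regret π θ T / Real.log T : ℝ) : EReal)) atTop := by
  choose u hu huniq using hopt
  -- A context at least as good as the optimum is itself optimal, so uniqueness makes every other
  -- gap positive.
  have hgap : ∀ (i : V) (w : A i), w ≠ (⟨u i, (hu i).1⟩ : A i) →
      0 < GraphBandit.gap θ (⟨i, w⟩ : GraphBandit.Arm A) := by
    intro i w hw
    refine GraphBandit.gap_pos_of_lt θ ⟨i, w⟩ ⟨u i, (hu i).1⟩ (lt_of_not_ge fun hle => hw ?_)
    exact Subtype.ext (huniq i w ⟨w.2, fun v hv => ((hu i).2 v hv).trans hle⟩)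
  have hpd : ∀ i, ∀ᶠ T : ℕ in atTop, (GraphBandit.expGram π θ T i).PosDef := fun i =>
    hπ.eventually_posDef (a := ⟨i, ⟨u i, (hu i).1⟩⟩) (hspan i) (hgap i)
  have hle : ∀ a ∈ GraphBandit.subopt A θ, ∀ b > GraphBandit.gap θ a ^ 2 / 2,
      ∀ᶠ T : ℕ in atTop, Real.log T *
        GraphBandit.wnormSq (GraphBandit.expGram π θ T a.1)⁻¹ (a.2 : Fin d → ℝ) ≤ b :=
    fun a ha b hb => hπ.eventually_log_mul_wnormSq_le (a := ⟨a.1, ⟨u a.1, (hu a.1).1⟩⟩)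
      (hspan a.1) (hgap a.1) (hu a.1).2 (u := a.2) ha hb
  refine ⟨hpd, fun a ha => ?_, GraphBandit.optValue_le_of_forall (fun a _ => hpd a.1) hle⟩
  refine le_of_forall_gt fun c hc => ?_
  obtain ⟨b, hb1, hb2⟩ := EReal.lt_iff_exists_real_btwn.1 hc
  refine lt_of_le_of_lt (limsup_le_of_le (h := ?_)) hb2
  filter_upwards [hle a ha b (EReal.coe_lt_coe_iff.1 hb1)] with T hT
  exact EReal.coe_le_coe_iff.2 hT
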